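/- Let $\mathcal V$ be a finite vocabulary, $T\ge 0$ a horizon, $M\ge 1$ a batch size. Let $p$ (draft model) and $q$ (target model) be autoregressive models: for every history $x_{1:n-1}$ they give probability distributions $p_n(\cdot\mid x_{1:n-1})$, $q_n(\cdot\mid x_{1:n-1})$ on $\mathcal V$; put $q(x_{1:n})=\prod_{i=1}^n q_i(x_i\mid x_{1:i-1})$. For distributions $\mu,\nu$ on $\mathcal V$, $\mathsf{TV}(\mu,\nu)=\frac12\sum_x|\mu(x)-\nu(x)|$, and $[\mu-\nu]_+$ is the normalization of $\max\{0,\mu(x)-\nu(x)\}$ (if $\mu=\nu$, put $[\mu-\nu]_+=\mu$). For each history let $q^1=q$ and $q^{m+1}=[q^m-p]_+$ for $1\le m\le M$. Batch speculative decoding works in rounds until $T$ tokens are output. A round that starts after the output $x_{1:n-1}$ draws $M$ independent draft responses $\tilde x^m_{n:T}$, $m=1,\dots,M$, autoregressively from $p$ given $x_{1:n-1}$. For $m=1,2,\dots,M$ in turn, the first token $\tilde x^m_n$ is accepted if $r\le\min\{1,q^m_n(\tilde x^m_n\mid x_{1:n-1})/p_n(\tilde x^m_n\mid x_{1:n-1})\}$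 for a fresh $r\sim\mathrm{Unif}[0,1]$, and otherwise the next response is examined. If all $M$ first tokens fail, $x_n$ is drawn from $q_n^{M+1}(\cdot\mid x_{1:n-1})$, this is a rejection ($R_n=1$), and the round ends. If $\tilde x^m_n$ is accepted, it becomes $x_n$ ($R_n=0$) and only response $m$ is followed: for $t=n+1,\dots,T$, $\tilde x^m_t$ is accepted ($x_t=\tilde x^m_t$, $R_t=0$) if a fresh uniform $r$ is at most $\min\{1,q_t(\tilde x^m_t\mid x_{1:t-1})/p_t(\tilde x^m_t\mid x_{1:t-1})\}$; at the first failure $x_t$ is drawn from $[q_t-p_t]_+(\cdot\mid x_{1:t-1})$, this is a rejection ($R_t=1$), and the round ends. Let $N_{\rm rej}=\sum_{n=1}^T R_n$. For $1\le n\le T$ let $f(x_{1:n})$ be the probability that the first $n$ output tokens are $x_{1:n}$ and $R_n=1$, and let $f(x_{1:0})=1$ (decoding starts with a fresh batch). Then the following hold. (1) For all $x_{1:T}\in\mathcal V^T$, $\mathbb P^{\rm Batch}(x_{1:T})=q(x_{1:T})$. (2) $\displaystyle\mathbb E[N_{\rm rej}]=\sum_{n=1}^T\mathbb E_{x_{1:n-1}\sim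 q}\big[\mathsf{TV}(q,p)(x_{1:n-1})\big]-\mathrm{BI}$, where $$\mathrm{BI}=\sum_{n=1}^T\sum_{x_{1:n-1}}f(x_{1:n-1})\Big[\mathsf{TV}(q,p)(x_{1:n-1})-\prod_{m=1}^M\mathsf{TV}(q^m,p)(x_{1:n-1})\Big]\ \ge 0$$ and $\mathsf{TV}(q^m,p)(x_{1:n-1})$ is the distance between $q^m_n(\cdot\mid x_{1:n-1})$ and $p_n(\cdot\mid x_{1:n-1})$. (3) $f$ is determined by $f(x_{1:0})=1$ and the recursion, for $1\le n\le T$ with $h(x_n)=\max\{0,q_n(x_n\mid x_{1:n-1})-p_n(x_n\mid x_{1:n-1})\}$, $$f(x_{1:n})=h(x_n)\,q(x_{1:n-1})-\Big(h(x_n)-\Big(\prod_{m=1}^M\mathsf{TV}(q^m,p)(x_{1:n-1})\Big)q^{M+1}_n(x_n\mid x_{1:n-1})\Big)f(x_{1:n-1}).$$ -/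

import Mathlib

open scoped ENNReal

noncomputable section

namespace BatchSD

variable {V : Type*}

/-- `q(x_{1:n}) = ∏ᵢ qᵢ(xᵢ | x_{1:i-1})`, for a model `q` that sends each history `x_{1:i-1}`
to the law of the next token. -/
def seqProb (q : List V → PMF V) (x : List V) : ℝ :=
  ∏ i : Fin x.length, (q (x.take i) (x.get i)).toReal

/-- Total variation distance of two laws on a finite vocabulary. -/
def TV [Fintype V] (q p : PMF V) : ℝ :=
  (∑ x, |(q x).toReal - (p x).toReal|) / 2

theorem tsum_sub_ne_top (q p : PMF V) : (∑' x, (q x - p x)) ≠ ∞ := by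
  refine ne_top_of_le_ne_top ENNReal.one_ne_top ?_
  calc (∑' x, (q x - p x)) ≤ ∑' x, q x := ENNReal.tsum_le_tsum fun x => tsub_le_self
    _ = 1 := q.tsum_coe

open Classical in
/-- `[q - p]₊`: the law with mass function proportional to `max 0 (q x - p x)`
(subtraction in `ℝ≥0∞` is truncated at `0`). When `q = p` there is nothing to normalize; then it
is `q` by convention. -/
def posPart (q p : PMF V) : PMF V :=
  if h : (∑' x, (q x - p x)) = 0 then q
  else PMF.normalize (fun x => q x - p x) h (tsum_sub_ne_top q p)

/-- The residual laws with index shifted by one: `resid q p m` is `q^{m+1}`, so that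
`resid q p 0 = q^1 = q` and `q^{m+1} = [q^m - p]₊`. -/
def resid (q p : PMF V) : ℕ → PMF V
  | 0 => q
  | m + 1 => posPart (resid q p m) p

theorem measurable_test (b : ℝ) : Measurable fun r : unitInterval => decide ((r : ℝ) ≤ b) := by
  refine measurable_to_bool ?_
  have h : (fun r : unitInterval => decide ((r : ℝ) ≤ b)) ⁻¹' {true} =
      ({r | (r : ℝ) ≤ b} : Set unitInterval) := by
    apply Set.ext; intro r; simp
  rw [h]
  exact measurableSet_le measurable_subtype_coe measurable_const

instance isProbabilityMeasure_test (b : ℝ) : MeasureTheory.IsProbabilityMeasure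
    (MeasureTheory.Measure.map (fun r : unitInterval => decide ((r : ℝ) ≤ b))
      MeasureTheory.volume) :=
  MeasureTheory.Measure.isProbabilityMeasure_map (measurable_test b).aemeasurable

/-- Draw `r` uniformly from `[0, 1]` and return whether `r ≤ b`. -/
def uniformTest (b : ℝ) : PMF Bool :=
  (MeasureTheory.Measure.map (fun r : unitInterval => decide ((r : ℝ) ≤ b))
    MeasureTheory.volume).toPMF

/-- The acceptance test of a draft token `x` for target law `q` and draft law `p`:
`r ≤ min {1, q x / p x}` with `r` uniform on `[0, 1]`. -/
def accept (q p : PMF V) (x : V) : PMF Bool :=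
  uniformTest (min 1 ((q x).toReal / (p x).toReal))

/-- One draft response: `k` tokens sampled from `p`, each given `h` and the earlier ones. -/
def draft (p : List V → PMF V) : ℕ → List V → PMF (List V)
  | 0, _ => PMF.pure []
  | k + 1, h => (p h).bind fun x => (draft p k (h ++ [x])).map (x :: ·)

/-- `M` independent draft responses of length `k` after the history `h`. -/
def drafts (p : List V → PMF V) (k : ℕ) (h : List V) : ℕ → PMF (List (List V))
  | 0 => PMF.pure []
  | M + 1 => (draft p k h).bind fun d => (drafts p k h M).map (d :: ·)

/-- Verification of the rest of a response whose first token was accepted; `h` is the history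
verified so far. Tokens are accepted one by one; at the first failure a token from `[q - p]₊` is
output and the round ends. Each output token carries its flag `R_n` (`true`: rejection). -/
def verifyTail (p q : List V → PMF V) : List V → List V → PMF (List (V × Bool))
  | _, [] => PMF.pure []
  | h, x :: xs => (accept (q h) (p h) x).bind fun a =>
      if a then (verifyTail p q (h ++ [x]) xs).map ((x, false) :: ·)
      else (posPart (q h) (p h)).map fun y => [(y, true)]

/-- Depth-first verification of a batch of responses after the verified history `h`; the `PMF`
argument is the current target law at the root. If the first token of a response is accepted, only
that response is followed. If it fails, the root law `q^m` becomes `[q^m - p]₊` and the next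
response is examined. If the first tokens of all responses fail, the next token is drawn from the
final residual law, and this is a rejection. -/
def verifyRoot (p q : List V → PMF V) (h : List V) :
    PMF V → List (List V) → PMF (List (V × Bool))
  | qm, [] => qm.map fun y => [(y, true)]
  | qm, [] :: ds => verifyRoot p q h qm ds
  | qm, (x :: xs) :: ds => (accept qm (p h) x).bind fun a =>
      if a then (verifyTail p q (h ++ [x]) xs).map ((x, false) :: ·)
      else verifyRoot p q h (posPart qm (p h)) ds

/-- The tokens of a run, without their flags. -/
def tokens (s : List (V × Bool)) : List V := s.map Prod.fst

/-- One round: draw `M` responses up to the horizon `T`, verify them, append the outcome. -/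
def round (p q : List V → PMF V) (M T : ℕ) (s : List (V × Bool)) : PMF (List (V × Bool)) :=
  (drafts p (T - s.length) (tokens s) M).bind fun ds =>
    (verifyRoot p q (tokens s) (q (tokens s)) ds).map (s ++ ·)

/-- Rounds are repeated while fewer than `T` tokens are verified, for at most `k` rounds. -/
def loop (p q : List V → PMF V) (M T : ℕ) : ℕ → List (V × Bool) → PMF (List (V × Bool))
  | 0, s => PMF.pure s
  | k + 1, s => if s.length < T then (round p q M T s).bind (loop p q M T k) else PMF.pure s

/-- Law of the run of batch speculative decoding with draft model `p`, target model `q`, batch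
size `M` and horizon `T`: the `n`-th entry is `(x_n, R_n)`. Every round adds at least one token,
so `T` rounds suffice. -/
def batchSD (p q : List V → PMF V) (M T : ℕ) : PMF (List (V × Bool)) :=
  loop p q M T T []

/-- `N_rej = ∑ₙ R_n`. -/
def numRej (s : List (V × Bool)) : ℕ := s.countP Prod.snd

/-- The pseudo-measure `f(x_{1:n}) = ℙ(x_{1:n} is output and the n-th draft token is rejected)`.
For the empty prefix it is `1`: decoding starts with a new batch, just as after a rejection. -/
def f (p q : List V → PMF V) (M T : ℕ) : List V → ℝ
  | [] => 1
  | x => ((batchSD p q M T).toOuterMeasure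
      {o | ∃ s y, s ++ [(y, true)] <+: o ∧ tokens (s ++ [(y, true)]) = x}).toReal

/-- `∏_{m=1}^M TV(q^m, p)(h)`. -/
def tvProd [Fintype V] (p q : List V → PMF V) (M : ℕ) (h : List V) : ℝ :=
  ∏ m ∈ Finset.range M, TV (resid (q h) (p h) m) (p h)

/-- `∑_{n=1}^T 𝔼_{x_{1:n-1} ∼ q} [TV(q, p)(x_{1:n-1})]`; here `n` counts the tokens of the
prefix. -/
def nonBatchRej [Fintype V] (p q : List V → PMF V) (T : ℕ) : ℝ :=
  ∑ n ∈ Finset.range T, ∑ x : Fin n → V,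
    seqProb q (List.ofFn x) * TV (q (List.ofFn x)) (p (List.ofFn x))

/-- The batch improvement
`∑_{n=1}^T ∑_{x_{1:n-1}} f(x_{1:n-1}) (TV(q, p)(x_{1:n-1}) - ∏_{m=1}^M TV(q^m, p)(x_{1:n-1}))`. -/
def batchImprovement [Fintype V] (p q : List V → PMF V) (M T : ℕ) : ℝ :=
  ∑ n ∈ Finset.range T, ∑ x : Fin n → V,
    f p q M T (List.ofFn x) *
      (TV (q (List.ofFn x)) (p (List.ofFn x)) - tvProd p q M (List.ofFn x))

end BatchSD

end

open scoped ENNReal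

noncomputable section

namespace BatchSD

variable {V : Type*}

/-! Draft tokens that are never examined can be integrated out, so decoding is a token-by-token
chain whose state is the history together with the last flag: after a rejection (or at the start)
the next token comes from `tokenStep` with `M` candidates, after an acceptance with one. This is
`loop_eq_run_aux`.

One examination accepts `y` with mass `min (p y) (q y)` and fails with mass `TV q p`, independently
of what follows. Since `min p q + (q - p)₊ = q`, every `tokenStep` outputs law `q`, while its
rejected part is `∏ TV(q^m, p) · q^{M+1}`, which for one candidate is `(q - p)₊`.

Hence in `tokenLaw` the two flags of a history `h` carry total mass `q(h)`, and flag `true` carries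
`f(h)`, so flag `false` carries `q(h) - f(h)`. Splitting the next step by flag gives the recursion
for `f`. It also gives the rejection probability `(q - f) TV + f ∏ TV = q TV - f (TV - ∏ TV)`, to be
summed over histories. -/

/-! ### Reduction of rounds to a token-by-token chain -/

/-- The flag of the last entry of a run; `true` for the empty run. -/
def lastFlag (s : List (V × Bool)) : Bool := (s.getLast?.map Prod.snd).getD true

@[simp] theorem lastFlag_nil : lastFlag ([] : List (V × Bool)) = true := rfl

@[simp] theorem lastFlag_append_singleton (s : List (V × Bool)) (z : V × Bool) :
    lastFlag (s ++ [z]) = z.2 := by simp [lastFlag]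

@[simp] theorem tokens_append_singleton (s : List (V × Bool)) (z : V × Bool) :
    tokens (s ++ [z]) = tokens s ++ [z.1] := by simp [tokens]

@[simp] theorem length_tokens (s : List (V × Bool)) : (tokens s).length = s.length := by
  simp [tokens]

/-- Law of the next output token and its flag when the first tokens of `M` responses drawn
from `p` are examined in turn, with current target law `q`. -/
def tokenStep (p : PMF V) : ℕ → PMF V → PMF (V × Bool)
  | 0, q => q.map fun y => (y, true)
  | M + 1, q => p.bind fun x => (accept q p x).bind fun a =>
      if a then PMF.pure (x, false) else tokenStep p M (posPart q p)

/-- The rest of a round with draft length `k + 1`, after its first output. -/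
def roundTail (p q : List V → PMF V) (k : ℕ) (h : List V) (z : V × Bool) :
    PMF (List (V × Bool)) :=
  if z.2 then PMF.pure [(z.1, true)]
  else ((draft p k (h ++ [z.1])).bind (verifyTail p q (h ++ [z.1]))).map ((z.1, false) :: ·)

/-- The acceptance test reads only the first draft token, so it can be drawn before the rest of the
response, which disappears upon failure. -/
theorem draft_bind_verifyTail (p q : List V → PMF V) (k : ℕ) (h : List V) :
    (draft p (k + 1) h).bind (verifyTail p q h) =
      (tokenStep (p h) 1 (q h)).bind (roundTail p q k h) := by
  simp only [draft, tokenStep, PMF.bind_bind, PMF.bind_map, Function.comp_def]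
  congr 1; funext x
  simp only [verifyTail]
  rw [PMF.bind_comm]
  congr 1; funext a
  cases a
  · simp [roundTail, PMF.map, Function.comp_def]
  · simp [roundTail, PMF.map_bind]

theorem drafts_bind_verifyRoot (p q : List V → PMF V) (k : ℕ) (h : List V) (M : ℕ)
    (r : PMF V) :
    (drafts p (k + 1) h M).bind (verifyRoot p q h r) =
      (tokenStep (p h) M r).bind (roundTail p q k h) := by
  induction M generalizing r with
  | zero => simp [drafts, verifyRoot, tokenStep, PMF.map, roundTail,
      Function.comp_def]
  | succ M ih =>
    simp only [drafts, draft, tokenStep, PMF.bind_bind, PMF.bind_map, Function.comp_def]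
    congr 1; funext x
    simp only [verifyRoot]
    -- The test is moved ahead of the later responses, then ahead of the tail of this one; each
    -- branch then discards the draws it does not read.
    simp_rw [PMF.bind_comm (drafts p (k + 1) h M)]
    rw [PMF.bind_comm]
    congr 1; funext a
    cases a
    · simpa using ih _
    · simp [roundTail, PMF.map_bind]

/-- One output token after the run `s`. -/
def step (p q : List V → PMF V) (M : ℕ) (s : List (V × Bool)) : PMF (List (V × Bool)) :=
  (tokenStep (p (tokens s)) (if lastFlag s then M else 1) (q (tokens s))).map fun z => s ++ [z]

/-- `k` output tokens after the run `s`. -/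
def run (p q : List V → PMF V) (M : ℕ) : ℕ → List (V × Bool) → PMF (List (V × Bool))
  | 0, s => PMF.pure s
  | k + 1, s => (step p q M s).bind (run p q M k)

theorem run_add (p q : List V → PMF V) (M k l : ℕ) (s : List (V × Bool)) :
    run p q M (k + l) s = (run p q M k s).bind (run p q M l) := by
  induction k generalizing s with
  | zero => simp [run]
  | succ k ih => simp [Nat.succ_add, run, PMF.bind_bind, funext ih]

theorem run_succ (p q : List V → PMF V) (M k : ℕ) (s : List (V × Bool)) :
    run p q M (k + 1) s = (run p q M k s).bind (step p q M) := by
  rw [run_add]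
  congr 1; funext t
  simp [run]

theorem loop_of_length_eq (p q : List V → PMF V) (M T j : ℕ) {s : List (V × Bool)}
    (hs : s.length = T) : loop p q M T j s = PMF.pure s := by
  cases j <;> simp [loop, hs]

/-- Both cases need one joint induction: an acceptance leaves the chain inside a round with a
pending draft, a rejection starts a new round. Each round outputs a token, so `k ≤ j` rounds are
enough. -/
theorem loop_eq_run_aux (p q : List V → PMF V) (M T k : ℕ) :
    ∀ (s : List (V × Bool)) (j : ℕ), s.length + k = T → k ≤ j →
      (lastFlag s = true → loop p q M T j s = run p q M k s) ∧
      (lastFlag s = false → ((draft p k (tokens s)).bind (verifyTail p q (tokens s))).bind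
        (fun o => loop p q M T j (s ++ o)) = run p q M k s) := by
  induction k with
  | zero =>
    intro s j hs _
    have := loop_of_length_eq p q M T j (s := s) hs
    simp [run, this, draft, verifyTail]
  | succ k ih =>
    intro s j hs hj
    have key : ∀ j', k ≤ j' → ∀ z, (roundTail p q k (tokens s) z).bind
        (fun o => loop p q M T j' (s ++ o)) = run p q M k (s ++ [z]) := by
      rintro j' hj' ⟨x, b⟩
      have h := ih (s ++ [(x, b)]) j' (by simp; omega) hj'
      cases b
      · simpa [roundTail, PMF.bind_map, Function.comp_def] using h.2 (by simp)
      · simpa [roundTail] using h.1 (by simp)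
    refine ⟨fun hf => ?_, fun hf => ?_⟩
    · obtain ⟨j, rfl⟩ := Nat.exists_eq_add_of_le' (show 1 ≤ j by omega)
      have hlt : s.length < T := by omega
      have hk : T - s.length = k + 1 := by omega
      simp only [loop, hlt, if_true, round, hk, drafts_bind_verifyRoot, run, step, hf,
        PMF.bind_bind, PMF.bind_map, ← PMF.map_bind, Function.comp_def]
      congr 1; funext z
      exact key j (by omega) z
    · rw [draft_bind_verifyTail]
      simp only [run, step, hf, PMF.bind_bind, PMF.bind_map, Function.comp_def]
      simp only [Bool.false_eq_true, if_false]
      congr 1; funext z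
      exact key j (by omega) z

theorem batchSD_eq_run (p q : List V → PMF V) (M T : ℕ) :
    batchSD p q M T = run p q M T [] :=
  (loop_eq_run_aux p q M T T [] T (by simp) le_rfl).1 rfl

/-! ### Excess mass, total variation and the acceptance test -/

/-- The total mass of the positive part of `q - p`, in `ℝ≥0∞`. -/
def excess (q p : PMF V) : ℝ≥0∞ := ∑' x, (q x - p x)

theorem toReal_sub (q p : PMF V) (x : V) :
    (q x - p x).toReal = max 0 ((q x).toReal - (p x).toReal) := by
  rcases le_total (p x) (q x) with h | h
  · rw [ENNReal.toReal_sub_of_le h (q.apply_ne_top x), max_eq_right]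
    exact sub_nonneg.2 (ENNReal.toReal_mono (q.apply_ne_top x) h)
  · rw [tsub_eq_zero_of_le h, max_eq_left, ENNReal.toReal_zero]
    exact sub_nonpos.2 (ENNReal.toReal_mono (p.apply_ne_top x) h)

theorem sum_toReal [Fintype V] (q : PMF V) : ∑ x, (q x).toReal = 1 := by
  rw [← ENNReal.toReal_sum fun x _ => q.apply_ne_top x, ← tsum_fintype (L := .unconditional V),
    q.tsum_coe, ENNReal.toReal_one]

theorem toReal_excess [Fintype V] (q p : PMF V) : (excess q p).toReal = TV q p := by
  have h : ∀ a b : ℝ, max 0 (a - b) = (|a - b| + (a - b)) / 2 := by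
    intro a b
    rcases le_total 0 (a - b) with h | h
    · rw [max_eq_right h, abs_of_nonneg h]; ring
    · rw [max_eq_left h, abs_of_nonpos h]; ring
  rw [excess, tsum_fintype, ENNReal.toReal_sum fun x _ => ENNReal.sub_ne_top (q.apply_ne_top x)]
  simp only [toReal_sub, h, ← Finset.sum_div, Finset.sum_add_distrib, Finset.sum_sub_distrib,
    sum_toReal, TV]
  ring

theorem TV_comm [Fintype V] (q p : PMF V) : TV q p = TV p q := by
  simp only [TV, abs_sub_comm]

theorem excess_ne_top (q p : PMF V) : excess q p ≠ ∞ := tsum_sub_ne_top q p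

/-- Both laws have mass `1`, so the positive and negative parts of `q - p` have equal mass. -/
theorem excess_comm [Fintype V] (q p : PMF V) : excess q p = excess p q := by
  rw [← ENNReal.toReal_eq_toReal_iff' (excess_ne_top q p) (excess_ne_top p q),
    toReal_excess, toReal_excess, TV_comm]

theorem excess_le_one (q p : PMF V) : excess q p ≤ 1 :=
  (ENNReal.tsum_le_tsum fun _ => tsub_le_self).trans_eq q.tsum_coe

theorem TV_nonneg [Fintype V] (q p : PMF V) : 0 ≤ TV q p :=
  toReal_excess q p ▸ ENNReal.toReal_nonneg

theorem TV_le_one [Fintype V] (q p : PMF V) : TV q p ≤ 1 :=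
  toReal_excess q p ▸ ENNReal.toReal_mono ENNReal.one_ne_top (excess_le_one q p)

/-- When the excess vanishes both sides are `0`, so the convention in `posPart` plays no role. -/
theorem excess_mul_posPart (q p : PMF V) (y : V) :
    excess q p * posPart q p y = q y - p y := by
  by_cases h : (∑' x, (q x - p x)) = 0
  · rw [excess, h, zero_mul]
    exact (ENNReal.tsum_eq_zero.1 h y).symm
  · rw [posPart, dif_neg h, PMF.normalize_apply, excess, mul_left_comm,
      ENNReal.mul_inv_cancel h (tsum_sub_ne_top q p), mul_one]

theorem uniformTest_true {b : ℝ} (h0 : 0 ≤ b) (h1 : b ≤ 1) :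
    uniformTest b true = ENNReal.ofReal b := by
  have h : (fun r : unitInterval => decide ((r : ℝ) ≤ b)) ⁻¹' {true} =
      Set.Iic (⟨b, h0, h1⟩ : unitInterval) := by
    ext r; simp [← Subtype.coe_le_coe]
  rw [uniformTest, MeasureTheory.Measure.toPMF_apply,
    MeasureTheory.Measure.map_apply (measurable_test b) (measurableSet_singleton _), h]
  simp

theorem mul_accept_true (q p : PMF V) (x : V) :
    p x * accept q p x true = min (p x) (q x) := by
  have hp := p.apply_ne_top x
  have hq := q.apply_ne_top x
  have hb : 0 ≤ min 1 ((q x).toReal / (p x).toReal) := le_min zero_le_one (by positivity)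
  rw [accept, uniformTest_true hb (min_le_left _ _)]
  by_cases h0 : p x = 0
  -- The quotient by zero is harmless: such a token is never drafted.
  · simp [h0]
  · have hpos : 0 < (p x).toReal := ENNReal.toReal_pos h0 hp
    rw [← ENNReal.toReal_eq_toReal_iff' (ENNReal.mul_ne_top hp ENNReal.ofReal_ne_top)
      (by simp [hp]), ENNReal.toReal_mul, ENNReal.toReal_ofReal hb, ENNReal.toReal_min hp hq,
      mul_min_of_nonneg _ _ hpos.le, mul_one, mul_div_cancel₀ _ hpos.ne']

theorem mul_accept_false (q p : PMF V) (x : V) :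
    p x * accept q p x false = p x - q x := by
  have hsum : accept q p x false + accept q p x true = 1 := by
    rw [← (accept q p x).tsum_coe, tsum_bool]
  have h : p x * accept q p x false + min (p x) (q x) = p x := by
    rw [← mul_accept_true, ← mul_add, hsum, mul_one]
  have hne : min (p x) (q x) ≠ ∞ := ((min_le_left _ _).trans_lt (p.apply_lt_top x)).ne
  rw [ENNReal.eq_sub_of_add_eq hne h]
  rcases le_total (p x) (q x) with h | h
  · rw [min_eq_left h, tsub_self, tsub_eq_zero_of_le h]
  · rw [min_eq_right h]

/-! ### The law of one output token -/

theorem resid_succ' (q p : PMF V) (m : ℕ) :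
    resid q p (m + 1) = resid (posPart q p) p m := by
  induction m with
  | zero => rfl
  | succ m ih => rw [resid, ih, resid]

/-- What follows a failure does not depend on the failed token, so the failure mass factors out.
That mass is `excess p q`, which equals `excess q p`. -/
theorem tokenStep_succ_apply [Fintype V] (p : PMF V) (M : ℕ) (q : PMF V) (z : V × Bool) :
    tokenStep p (M + 1) q z = excess q p * tokenStep p M (posPart q p) z +
      if z.2 then 0 else min (p z.1) (q z.1) := by
  classical
  obtain ⟨y, b⟩ := z
  rw [tokenStep, PMF.bind_apply, excess_comm, excess, ← ENNReal.tsum_mul_right]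
  simp only [PMF.bind_apply, tsum_bool, mul_add, ← mul_assoc, mul_accept_true, mul_accept_false,
    if_true, Bool.false_eq_true, if_false]
  rw [ENNReal.tsum_add]
  congr 1
  cases b
  · rw [tsum_eq_single y fun x hx => by simp [PMF.pure_apply, hx.symm]]
    simp
  · simp [PMF.pure_apply]

/-- The probability that `M` first tokens drawn from `p` all fail. -/
def rejMass (p : PMF V) (M : ℕ) (q : PMF V) : ℝ≥0∞ :=
  ∏ m ∈ Finset.range M, excess (resid q p m) p

theorem tokenStep_true [Fintype V] (p : PMF V) (M : ℕ) (q : PMF V) (y : V) :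
    tokenStep p M q (y, true) = rejMass p M q * resid q p M y := by
  classical
  induction M generalizing q with
  | zero =>
    rw [tokenStep, PMF.map_apply, tsum_eq_single y fun x hx => by simp [hx.symm]]
    simp [rejMass, resid]
  | succ M ih =>
    rw [tokenStep_succ_apply, ih, rejMass, rejMass, Finset.prod_range_succ', resid_succ',
      if_pos rfl, add_zero]
    simp_rw [resid_succ' q p]
    rw [resid]
    ring

/-- Unbiasedness of one step: by induction the mass after a failure is `excess q p * posPart q p y =
q y - p y` (truncated), which `min (p y) (q y)` completes to `q y`. -/
theorem tokenStep_false_add_true [Fintype V] (p : PMF V) (M : ℕ) (q : PMF V) (y : V) :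
    tokenStep p M q (y, false) + tokenStep p M q (y, true) = q y := by
  classical
  induction M generalizing q with
  | zero =>
    have h : tokenStep p 0 q (y, false) = 0 := by simp [tokenStep, PMF.map_apply]
    rw [h, zero_add, tokenStep_true]
    simp [rejMass, resid]
  | succ M ih =>
    rw [tokenStep_succ_apply, tokenStep_succ_apply, if_pos rfl, if_neg (by simp), add_zero,
      add_right_comm, ← mul_add, ih, excess_mul_posPart]
    rcases le_total (p y) (q y) with h | h
    · rw [min_eq_left h, tsub_add_cancel_of_le h]
    · rw [min_eq_right h, tsub_eq_zero_of_le h, zero_add]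

theorem tokenStep_one_true [Fintype V] (p q : PMF V) (y : V) :
    tokenStep p 1 q (y, true) = q y - p y := by
  rw [tokenStep_true]
  simp [rejMass, resid, excess_mul_posPart]

theorem rejMass_one (p q : PMF V) : rejMass p 1 q = excess q p := by
  simp [rejMass, resid]

theorem toReal_rejMass [Fintype V] (p q : List V → PMF V) (M : ℕ) (h : List V) :
    (rejMass (p h) M (q h)).toReal = tvProd p q M h := by
  simp only [rejMass, tvProd, ENNReal.toReal_prod, toReal_excess]

theorem rejMass_ne_top (p : PMF V) (M : ℕ) (q : PMF V) : rejMass p M q ≠ ∞ :=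
  ENNReal.prod_ne_top fun _ _ => excess_ne_top _ _

/-! ### Expectations under `bind` and `map` -/

theorem tsum_bind_mul {α β : Type*} (μ : PMF α) (κ : α → PMF β) (g : β → ℝ≥0∞) :
    ∑' b, μ.bind κ b * g b = ∑' a, μ a * ∑' b, κ a b * g b := by
  simp only [PMF.bind_apply, ← ENNReal.tsum_mul_right, ← ENNReal.tsum_mul_left, mul_assoc]
  exact ENNReal.tsum_comm

theorem tsum_map_mul {α β : Type*} (μ : PMF α) (u : α → β) (g : β → ℝ≥0∞) :
    ∑' b, μ.map u b * g b = ∑' a, μ a * g (u a) := by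
  classical
  rw [PMF.map, tsum_bind_mul]
  congr 1; funext a
  rw [Function.comp_apply, tsum_eq_single (u a) fun b hb => by simp [PMF.pure_apply, hb]]
  simp

theorem tsum_tokenStep_reject [Fintype V] (p : PMF V) (M : ℕ) (q : PMF V) :
    ∑' z, tokenStep p M q z * (if z.2 then 1 else 0) = rejMass p M q := by
  rw [ENNReal.tsum_prod']
  simp only [tsum_bool, tokenStep_true, if_true, Bool.false_eq_true, if_false, mul_zero, zero_add,
    mul_one, ENNReal.tsum_mul_left, PMF.tsum_coe]

/-! ### The joint law of history and last flag -/

/-- Joint law of the first `n` output tokens and of the flag of the last of them. -/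
def tokenLaw (p q : List V → PMF V) (M n : ℕ) : PMF (List V × Bool) :=
  (run p q M n []).map fun s => (tokens s, lastFlag s)

theorem tokenLaw_zero (p q : List V → PMF V) (M : ℕ) :
    tokenLaw p q M 0 = PMF.pure ([], true) := by
  simp [tokenLaw, run, PMF.pure_map, tokens]

theorem tokenLaw_succ (p q : List V → PMF V) (M n : ℕ) :
    tokenLaw p q M (n + 1) = (tokenLaw p q M n).bind fun hb =>
      (tokenStep (p hb.1) (if hb.2 then M else 1) (q hb.1)).map fun z => (hb.1 ++ [z.1], z.2) := by
  simp [tokenLaw, run_succ, PMF.map_bind, PMF.bind_map, step, PMF.map_comp, Function.comp_def]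

/-- The new history determines its predecessor `h`, so only the two flags at `h` contribute. -/
theorem tokenLaw_succ_append (p q : List V → PMF V) (M n : ℕ) (h : List V) (z : V × Bool) :
    tokenLaw p q M (n + 1) (h ++ [z.1], z.2) =
      tokenLaw p q M n (h, false) * tokenStep (p h) 1 (q h) z +
        tokenLaw p q M n (h, true) * tokenStep (p h) M (q h) z := by
  classical
  rw [tokenLaw_succ, PMF.bind_apply, ENNReal.tsum_prod', tsum_eq_single h]
  · have key : ∀ μ : PMF (V × Bool),
        (μ.map fun z => (h ++ [z.1], z.2)) (h ++ [z.1], z.2) = μ z := by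
      intro μ
      rw [PMF.map_apply, tsum_eq_single z]
      · simp
      · rintro ⟨a, b⟩ hab
        obtain ⟨c, d⟩ := z
        rw [if_neg]
        simp only [Prod.mk.injEq, List.append_cancel_left_eq, List.cons.injEq, and_true]
        rintro ⟨rfl, rfl⟩
        exact hab rfl
    simp [key, add_comm]
  · intro h' hh
    refine ENNReal.tsum_eq_zero.2 fun b => ?_
    refine mul_eq_zero_of_right _ ?_
    rw [PMF.map_apply, ENNReal.tsum_eq_zero]
    intro z'
    rw [if_neg]
    simp only [Prod.mk.injEq, not_and]
    intro e
    exact absurd (List.append_inj' e rfl).1.symm hh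

theorem length_of_mem_support_run (p q : List V → PMF V) (M k : ℕ) {s o : List (V × Bool)}
    (ho : o ∈ (run p q M k s).support) : s <+: o ∧ o.length = s.length + k := by
  induction k generalizing s with
  | zero =>
    rw [run, PMF.mem_support_pure_iff] at ho
    subst ho; simp
  | succ k ih =>
    rw [run, PMF.mem_support_bind_iff] at ho
    obtain ⟨t, ht, ho⟩ := ho
    rw [step, PMF.mem_support_map_iff] at ht
    obtain ⟨z, -, rfl⟩ := ht
    have := ih ho
    refine ⟨(List.prefix_append _ _).trans this.1, ?_⟩
    rw [this.2]; simp; omega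

theorem tokenLaw_eq_zero (p q : List V → PMF V) (M n : ℕ) (h : List V) (b : Bool)
    (hn : h.length ≠ n) : tokenLaw p q M n (h, b) = 0 := by
  rw [PMF.apply_eq_zero_iff, tokenLaw, PMF.mem_support_map_iff]
  rintro ⟨s, hs, e⟩
  have := (length_of_mem_support_run p q M n hs).2
  apply hn
  rw [← (Prod.mk.inj e).1]
  simpa using this

theorem seqProb_append_singleton (q : List V → PMF V) (h : List V) (y : V) :
    seqProb q (h ++ [y]) = seqProb q h * (q h y).toReal := by
  have hl : h.length + 1 = (h ++ [y]).length := by simp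
  rw [seqProb, ← Fintype.prod_equiv (finCongr hl) _ _ fun _ => rfl, Fin.prod_univ_castSucc]
  congr 1
  · refine Finset.prod_congr rfl fun i _ => ?_
    simp [List.take_append_of_le_length i.2.le]
  · simp

theorem toReal_tokenLaw_add [Fintype V] (p q : List V → PMF V) (M : ℕ) (h : List V) :
    (tokenLaw p q M h.length (h, false)).toReal + (tokenLaw p q M h.length (h, true)).toReal =
      seqProb q h := by
  classical
  induction h using List.reverseRecOn with
  | nil => simp [tokenLaw_zero, PMF.pure_apply, seqProb]
  | append_singleton h y ih =>
    rw [seqProb_append_singleton, ← ih,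
      ← ENNReal.toReal_add (PMF.apply_ne_top _ _) (PMF.apply_ne_top _ _),
      ← ENNReal.toReal_add (PMF.apply_ne_top _ _) (PMF.apply_ne_top _ _), ← ENNReal.toReal_mul,
      List.length_append, List.length_singleton,
      tokenLaw_succ_append p q M h.length h (y, false),
      tokenLaw_succ_append p q M h.length h (y, true), add_add_add_comm, ← mul_add, ← mul_add,
      tokenStep_false_add_true, tokenStep_false_add_true, add_mul]

theorem toReal_tokenLaw_false [Fintype V] (p q : List V → PMF V) (M : ℕ) (h : List V) :
    (tokenLaw p q M h.length (h, false)).toReal =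
      seqProb q h - (tokenLaw p q M h.length (h, true)).toReal := by
  rw [← toReal_tokenLaw_add p q M h, add_sub_cancel_right]

/-- The event is decided by the first `x.length` outputs, since later steps only extend the run:
given those, it is certain or impossible. The value `f [] = 1` matches the flag `true` of the empty
run. -/
theorem f_eq_tokenLaw (p q : List V → PMF V) (M T : ℕ) (x : List V) (hx : x.length ≤ T) :
    f p q M T x = (tokenLaw p q M x.length (x, true)).toReal := by
  classical
  rcases eq_or_ne x [] with rfl | hne
  · simp [f, tokenLaw_zero]
  rw [f.eq_2 _ _ _ _ _ (fun e => hne e), batchSD_eq_run]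
  congr 1
  obtain ⟨k, rfl⟩ := Nat.exists_eq_add_of_le hx
  rw [run_add, PMF.toOuterMeasure_bind_apply, tokenLaw, PMF.map_apply]
  congr 1; funext a
  by_cases ha : a ∈ (run p q M x.length []).support
  swap
  · rw [(PMF.apply_eq_zero_iff _ _).2 ha]; simp
  have hlen : a.length = x.length := by simpa using (length_of_mem_support_run p q M _ ha).2
  split_ifs with h
  · rw [(PMF.toOuterMeasure_apply_eq_one_iff _ _).2, mul_one]
    intro o ho
    have hpre := (length_of_mem_support_run p q M _ ho).1
    obtain ⟨h1, h2⟩ := Prod.mk.inj h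
    rcases List.eq_nil_or_concat a with rfl | ⟨s, ⟨y, b⟩, rfl⟩
    · exact absurd (by simpa [tokens] using h1) hne
    · simp only [List.concat_eq_append, lastFlag_append_singleton] at h1 h2 hpre
      subst h2
      exact ⟨s, y, hpre, h1.symm⟩
  · rw [(PMF.toOuterMeasure_apply_eq_zero_iff _ _).2, mul_zero]
    rw [Set.disjoint_left]
    rintro o ho ⟨s, y, hs, ht⟩
    have hpre := (length_of_mem_support_run p q M _ ho).1
    have hl : (s ++ [(y, true)]).length = a.length := by rw [← length_tokens, ht, hlen]
    have e := (List.prefix_of_prefix_length_le hs hpre hl.le).eq_of_length hl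
    apply h
    rw [← e, ht, lastFlag_append_singleton]

/-! ### Expected number of rejections and the batch improvement -/

/-- The expected number of rejections among the first `n` output tokens. -/
def meanRej (p q : List V → PMF V) (M n : ℕ) : ℝ≥0∞ :=
  ∑' o, run p q M n [] o * (numRej o : ℝ≥0∞)

/-- The probability that the `n + 1`-st output token is a rejection. -/
theorem tsum_tokenLaw_rejMass [Fintype V] (p q : List V → PMF V) (M n : ℕ) :
    ∑' hb, tokenLaw p q M n hb * rejMass (p hb.1) (if hb.2 then M else 1) (q hb.1) =
      ∑ x : Fin n → V, (tokenLaw p q M n (List.ofFn x, false) *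
          excess (q (List.ofFn x)) (p (List.ofFn x)) +
        tokenLaw p q M n (List.ofFn x, true) *
          rejMass (p (List.ofFn x)) M (q (List.ofFn x))) := by
  -- Histories of length other than `n` have no mass, so the sum over all lists restricts to the
  -- range of `List.ofFn`.
  rw [ENNReal.tsum_prod', ← tsum_fintype (L := .unconditional _),
    ← (List.ofFn_injective (n := n)).tsum_eq]
  · simp only [tsum_bool, if_true, Bool.false_eq_true, if_false, rejMass_one]
  · intro h hh
    by_contra hr
    refine hh (ENNReal.tsum_eq_zero.2 fun b => ?_)
    rw [tokenLaw_eq_zero, zero_mul]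
    rintro rfl
    exact hr ⟨h.get, List.ofFn_get h⟩

theorem meanRej_succ [Fintype V] (p q : List V → PMF V) (M n : ℕ) :
    meanRej p q M (n + 1) = meanRej p q M n +
      ∑' hb, tokenLaw p q M n hb * rejMass (p hb.1) (if hb.2 then M else 1) (q hb.1) := by
  rw [meanRej, meanRej, run_succ, tsum_bind_mul, tokenLaw, tsum_map_mul, ← ENNReal.tsum_add]
  congr 1; funext s
  rw [← mul_add]
  congr 1
  rw [step, tsum_map_mul, ← tsum_tokenStep_reject]
  have h : ∀ z : V × Bool,
      (numRej (s ++ [z]) : ℝ≥0∞) = numRej s + if z.2 then 1 else 0 := by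
    rintro ⟨x, b⟩
    cases b <;> simp [numRej]
  simp only [h, mul_add, ENNReal.tsum_add, ENNReal.tsum_mul_right, PMF.tsum_coe, one_mul]

theorem meanRej_zero (p q : List V → PMF V) (M : ℕ) : meanRej p q M 0 = 0 := by
  classical
  refine ENNReal.tsum_eq_zero.2 fun o => ?_
  by_cases h : o = [] <;> simp [run, PMF.pure_apply, h, numRej]

theorem rejection_prob_ne_top [Fintype V] (p q : List V → PMF V) (M n : ℕ) (x : Fin n → V) :
    tokenLaw p q M n (List.ofFn x, false) * excess (q (List.ofFn x)) (p (List.ofFn x)) +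
      tokenLaw p q M n (List.ofFn x, true) *
        rejMass (p (List.ofFn x)) M (q (List.ofFn x)) ≠ ∞ :=
  ENNReal.add_ne_top.2 ⟨ENNReal.mul_ne_top (PMF.apply_ne_top _ _) (excess_ne_top _ _),
    ENNReal.mul_ne_top (PMF.apply_ne_top _ _) (rejMass_ne_top _ _ _)⟩

theorem meanRej_ne_top [Fintype V] (p q : List V → PMF V) (M n : ℕ) :
    meanRej p q M n ≠ ∞ := by
  induction n with
  | zero => simp [meanRej_zero]
  | succ n ih =>
    rw [meanRej_succ, tsum_tokenLaw_rejMass]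
    exact ENNReal.add_ne_top.2 ⟨ih, ENNReal.sum_ne_top.2 fun x _ =>
      rejection_prob_ne_top p q M n x⟩

theorem toReal_meanRej [Fintype V] (p q : List V → PMF V) (M T n : ℕ) (hn : n ≤ T) :
    (meanRej p q M n).toReal = ∑ k ∈ Finset.range n, ∑ x : Fin k → V,
      (seqProb q (List.ofFn x) * TV (q (List.ofFn x)) (p (List.ofFn x)) -
        f p q M T (List.ofFn x) *
          (TV (q (List.ofFn x)) (p (List.ofFn x)) - tvProd p q M (List.ofFn x))) := by
  induction n with
  | zero => simp [meanRej_zero]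
  | succ n ih =>
    rw [Finset.sum_range_succ, ← ih (by omega), meanRej_succ, tsum_tokenLaw_rejMass,
      ENNReal.toReal_add (meanRej_ne_top p q M n)
        (ENNReal.sum_ne_top.2 fun x _ => rejection_prob_ne_top p q M n x),
      ENNReal.toReal_sum fun x _ => rejection_prob_ne_top p q M n x]
    congr 1
    refine Finset.sum_congr rfl fun x _ => ?_
    have hf := f_eq_tokenLaw p q M T (List.ofFn x) (by simp; omega)
    have h0 := toReal_tokenLaw_false p q M (List.ofFn x)
    rw [List.length_ofFn] at hf h0
    have hne := ENNReal.add_ne_top.1 (rejection_prob_ne_top p q M n x)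
    rw [ENNReal.toReal_add hne.1 hne.2, ENNReal.toReal_mul, ENNReal.toReal_mul, h0, hf,
      toReal_excess, toReal_rejMass]
    ring

theorem hasSum_numRej [Fintype V] (p q : List V → PMF V) (M T : ℕ) :
    HasSum (fun o : List (V × Bool) => (batchSD p q M T o).toReal * (numRej o : ℝ))
      (nonBatchRej p q T - batchImprovement p q M T) := by
  have h := ENNReal.hasSum_toReal (meanRej_ne_top p q M T)
  rw [batchSD_eq_run]
  convert h using 1
  · funext o
    rw [ENNReal.toReal_mul, ENNReal.toReal_natCast]
  · refine Eq.trans ?_ (Eq.trans (toReal_meanRej p q M T T le_rfl).symm ?_)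
    · simp only [nonBatchRej, batchImprovement, Finset.sum_sub_distrib]
    · rw [meanRej, ENNReal.tsum_toReal_eq fun o => ENNReal.mul_ne_top (PMF.apply_ne_top _ _)
        (ENNReal.natCast_ne_top _)]

theorem f_nonneg (p q : List V → PMF V) (M T : ℕ) (x : List V) : 0 ≤ f p q M T x := by
  cases x with
  | nil => exact zero_le_one
  | cons a x => exact ENNReal.toReal_nonneg

theorem tvProd_le_TV [Fintype V] (p q : List V → PMF V) {M : ℕ} (hM : 1 ≤ M) (h : List V) :
    tvProd p q M h ≤ TV (q h) (p h) := by
  obtain ⟨M, rfl⟩ := Nat.exists_eq_add_of_le' hM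
  -- The factor of index `0` is `TV (q h) (p h)` itself; the others are at most `1`.
  rw [tvProd, Finset.prod_range_succ']
  exact mul_le_of_le_one_left (TV_nonneg _ _)
    (Finset.prod_le_one (fun _ _ => TV_nonneg _ _) fun _ _ => TV_le_one _ _)

theorem batchImprovement_nonneg [Fintype V] (p q : List V → PMF V) {M : ℕ} (T : ℕ)
    (hM : 1 ≤ M) : 0 ≤ batchImprovement p q M T :=
  Finset.sum_nonneg fun _ _ => Finset.sum_nonneg fun _ _ =>
    mul_nonneg (f_nonneg _ _ _ _ _) (sub_nonneg.2 (tvProd_le_TV p q hM _))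

theorem f_append_singleton [Fintype V] (p q : List V → PMF V) (M T : ℕ) (h : List V) (y : V)
    (hT : h.length < T) :
    f p q M T (h ++ [y]) =
      max 0 ((q h y).toReal - (p h y).toReal) * seqProb q h -
        (max 0 ((q h y).toReal - (p h y).toReal) -
          tvProd p q M h * (resid (q h) (p h) M y).toReal) * f p q M T h := by
  rw [f_eq_tokenLaw p q M T _ (by simpa using hT), f_eq_tokenLaw p q M T h hT.le,
    List.length_append, List.length_singleton,
    tokenLaw_succ_append p q M h.length h (y, true), ENNReal.toReal_add
      (ENNReal.mul_ne_top (PMF.apply_ne_top _ _) (PMF.apply_ne_top _ _))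
      (ENNReal.mul_ne_top (PMF.apply_ne_top _ _) (PMF.apply_ne_top _ _)),
    ENNReal.toReal_mul, ENNReal.toReal_mul, tokenStep_one_true, tokenStep_true,
    ENNReal.toReal_mul, toReal_sub, toReal_rejMass, toReal_tokenLaw_false]
  ring

theorem toReal_map_tokens_batchSD [Fintype V] (p q : List V → PMF V) (M T : ℕ)
    (x : Fin T → V) :
    ((batchSD p q M T).map tokens (List.ofFn x)).toReal = seqProb q (List.ofFn x) := by
  classical
  have h := toReal_tokenLaw_add p q M (List.ofFn x)
  rw [List.length_ofFn] at h
  have e : (batchSD p q M T).map tokens = (tokenLaw p q M T).map Prod.fst := by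
    rw [tokenLaw, PMF.map_comp, batchSD_eq_run]
    rfl
  rw [← h, ← ENNReal.toReal_add (PMF.apply_ne_top _ _) (PMF.apply_ne_top _ _), e, PMF.map_apply,
    ENNReal.tsum_prod', tsum_eq_single (List.ofFn x) fun h' hh => by simp [hh.symm]]
  simp [add_comm]

end BatchSD

end

/-- Unbiasedness, expected number of rejections, nonnegativity of the batch improvement, and the
recursion for `f`. -/
theorem theorem3 {V : Type*} [Fintype V] (p q : List V → PMF V) (M T : ℕ) (hM : 1 ≤ M) :
    (∀ x : Fin T → V,
      (((BatchSD.batchSD p q M T).map BatchSD.tokens) (List.ofFn x)).toReal =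
        BatchSD.seqProb q (List.ofFn x)) ∧
    HasSum (fun o : List (V × Bool) =>
        (BatchSD.batchSD p q M T o).toReal * (BatchSD.numRej o : ℝ))
      (BatchSD.nonBatchRej p q T - BatchSD.batchImprovement p q M T) ∧
    0 ≤ BatchSD.batchImprovement p q M T ∧
    (∀ (h : List V) (y : V), h.length < T →
      BatchSD.f p q M T (h ++ [y]) =
        max 0 ((q h y).toReal - (p h y).toReal) * BatchSD.seqProb q h -
          (max 0 ((q h y).toReal - (p h y).toReal) -
            BatchSD.tvProd p q M h * (BatchSD.resid (q h) (p h) M y).toReal) *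
          BatchSD.f p q M T h) := by
  exact ⟨BatchSD.toReal_map_tokens_batchSD p q M T, BatchSD.hasSum_numRej p q M T,
    BatchSD.batchImprovement_nonneg p q T hM, BatchSD.f_append_singleton p q M T⟩
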